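/- Let $X$ be a compact metric space, $\Sigma=X^{\mathbb Z}$ with the product topology, and let $\sigma$ be the left shift on $\Sigma$. Let $F:\Sigma\times\mathbb T^2\to\Sigma\times\mathbb T^2$, $F(x,p)=(\sigma(x),f_x(p))$, be continuous, where every $f_x$ is a homeomorphism of $\mathbb T^2=\mathbb R^2/\mathbb Z^2$ homotopic to the identity. Suppose that for every $x\in\Sigma$ a lift $\widetilde f_x:\mathbb R^2\to\mathbb R^2$ of $f_x$ is fixed, such that $(x,\widetilde p)\mapsto\widetilde f_x(\widetilde p)$ is continuous, and put $\widetilde F(x,\widetilde p)=(\sigma(x),\widetilde f_x(\widetilde p))$ and $\widetilde f_x^{\,n}=\widetilde f_{\sigma^{n-1}(x)}\circ\cdots\circ\widetilde f_{\sigma(x)}\circ\widetilde f_x$. For $n\ge 1$ let $D_n=\{\tfrac1n(\widetilde f_x^{\,n}(\widetilde p)-\widetilde p): x\in\Sigma,\ \widetilde p\in\mathbb R^2\}$ and let $\rho_{mz}(\widetilde F)=\bigcap_{N\ge1}\overline{\bigcup_{n\ge N}D_n}$. For a lift $\widetilde g:\mathbb R^2\to\mathbb R^2$ of a single homeomorphism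 of $\mathbb T^2$ homotopic to the identity, let $\rho(\widetilde g)=\bigcap_{N\ge1}\overline{\bigcup_{n\ge N}\{\tfrac1n(\widetilde g^{\,n}(\widetilde p)-\widetilde p):\widetilde p\in\mathbb R^2\}}$ be its Misiurewicz–Ziemian rotation set. For an $F$-invariant Borel probability measure $m$ on $\Sigma\times\mathbb T^2$ let $\rho(\widetilde F,m)=\int\rho_1\,dm$, where $\rho_1(x,p)=\widetilde f_x(\widetilde p)-\widetilde p$ for any $\widetilde p\in\mathbb R^2$ over $p$. For a $\sigma$-invariant Borel probability measure $\mu$ on $\Sigma$ let $\rho_\mu(\widetilde F)$ be the set of all $\rho(\widetilde F,m)$, where $m$ is an $F$-invariant Borel probability measure whose push-forward to $\Sigma$ is $\mu$. Let $\rho_{\mathrm{Per}(\sigma)}(\widetilde F)$ be the union of the sets $\rho_\mu(\widetilde F)$ over all $\sigma$-invariant Borel probability measures $\mu$ that are supported on a (single) periodic orbit of $\sigma$. Then: 1. $\rho_{\mathrm{Per}(\sigma)}(\widetilde F)\subset\rho_{mz}(\widetilde F)$. 2. If $x\in\Sigma$ and $n\ge1$ satisfy $\sigma^n(x)=x$,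 then the set of all rotation vectors $\rho(\widetilde F,m)$ of $F$-invariant Borel probability measures $m$ whose projection to $\Sigma$ is supported on the orbit of $x$ is equal to $\tfrac1n\,\rho(\widetilde f_x^{\,n})=\{v/n: v\in\rho(\widetilde f_x^{\,n})\}$. -/

import Mathlib

open MeasureTheory Set

namespace TorusCocycle

/-- The two-dimensional torus `ℝ² / ℤ²`. -/
abbrev T2 : Type := UnitAddTorus (Fin 2)

/-- The plane `ℝ²`; only its vector space structure and topology are used. -/
abbrev R2 : Type := Fin 2 → ℝ

/-- The covering map `π : ℝ² → 𝕋²`. -/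
def proj (p : R2) : T2 := fun i => (p i : UnitAddCircle)

/-- The point of `[0,1)²` lying over a given point of the torus. -/
noncomputable def rep (p : T2) : R2 := fun i => (AddCircle.equivIco (1 : ℝ) 0 (p i) : ℝ)

theorem proj_rep (p : T2) : proj (rep p) = p := by
  funext i
  exact AddCircle.coe_equivIco

/-- The left shift on `X^ℤ`. -/
def shift {X : Type*} (x : ℤ → X) : ℤ → X := fun k => x (k + 1)

/-- A random composition of homeomorphisms of the torus over the shift on `X^ℤ`: a continuous
skew product `(x, p) ↦ (σ x, f_x p)` on `X^ℤ × 𝕋²`, each `f_x` being a homeomorphism of `𝕋²`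
homotopic to the identity. -/
structure RCTH (X : Type*) [TopologicalSpace X] where
  fib : (ℤ → X) → (T2 ≃ₜ T2)
  continuous_fib : Continuous (fun q : (ℤ → X) × T2 => fib q.1 q.2)
  homotopic_id : ∀ x, ContinuousMap.Homotopic (fib x : C(T2, T2)) (ContinuousMap.id T2)

/-- The map `F (x, p) = (σ x, f_x p)`. -/
def RCTH.map {X : Type*} [TopologicalSpace X] (F : RCTH X) (q : (ℤ → X) × T2) :
    (ℤ → X) × T2 :=
  (shift q.1, F.fib q.1 q.2)

/-- A choice, for every `x`, of a lift `f̃_x : ℝ² → ℝ²` of `f_x`, depending continuously on `x`.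
Continuity of `x ↦ f̃_x` into the continuous maps (compact-open topology) is the same as joint
continuity, because `ℝ²` is locally compact. -/
structure RCTH.Lift {X : Type*} [TopologicalSpace X] (F : RCTH X) where
  fib : (ℤ → X) → R2 → R2
  continuous_fib : Continuous (fun q : (ℤ → X) × R2 => fib q.1 q.2)
  proj_fib : ∀ x p, proj (fib x p) = F.fib x (proj p)

/-- The Misiurewicz-Ziemian rotation set of a plane map `g`: the limit superior, as `n → ∞`, of
the sets of averaged displacements `(g^n p - p) / n`. -/
noncomputable def planeRotationSet (g : R2 → R2) : Set R2 :=
  ⋂ N : ℕ, closure (⋃ n : ℕ, ⋃ _ : N ≤ n,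
    Set.range (fun p : R2 => (n : ℝ)⁻¹ • (g^[n] p - p)))

/-- The invariant Borel probability measures of a map. -/
def invMeasures {α : Type*} [MeasurableSpace α] (T : α → α) : Set (Measure α) :=
  {μ | IsProbabilityMeasure μ ∧ MeasurePreserving T μ μ}

/-- The shift-invariant probability measures that are supported on the orbit of `x`. -/
def orbitMeasures {X : Type*} [MeasurableSpace X] (x : ℤ → X) : Set (Measure (ℤ → X)) :=
  {μ | μ ∈ invMeasures (shift (X := X)) ∧
    μ (Set.range (fun k : ℕ => shift^[k] x))ᶜ = 0}

/-- The shift-invariant probability measures that are supported on a periodic orbit. -/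
def perMeasures (X : Type*) [MeasurableSpace X] : Set (Measure (ℤ → X)) :=
  ⋃ x ∈ Function.periodicPts (shift (X := X)), orbitMeasures x

/-- The `F`-invariant probability measures that project to `μ`. -/
def RCTH.fiberMeasures {X : Type*} [TopologicalSpace X] [MeasurableSpace X] (F : RCTH X)
    (μ : Measure (ℤ → X)) : Set (Measure ((ℤ → X) × T2)) :=
  {m | m ∈ invMeasures F.map ∧ m.map Prod.fst = μ}

namespace RCTH.Lift

variable {X : Type*} [TopologicalSpace X] {F : RCTH X}

/-- The lifted cocycle `F̃ (x, p) = (σ x, f̃_x p)` on `X^ℤ × ℝ²`. -/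
def map (L : F.Lift) (q : (ℤ → X) × R2) : (ℤ → X) × R2 := (shift q.1, L.fib q.1 q.2)

/-- The composition `f̃^n_x = f̃_{σ^{n-1} x} ∘ ⋯ ∘ f̃_{σ x} ∘ f̃_x`. -/
def iter (L : F.Lift) : ℕ → (ℤ → X) → R2 → R2
  | 0, _, p => p
  | n + 1, x, p => L.fib (shift^[n] x) (L.iter n x p)

theorem map_iterate (L : F.Lift) (n : ℕ) (x : ℤ → X) (p : R2) :
    L.map^[n] (x, p) = (shift^[n] x, L.iter n x p) := by
  induction n with
  | zero => rfl
  | succ n ih => rw [Function.iterate_succ_apply', ih, Function.iterate_succ_apply']; rfl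

/-- The displacement `ρ₁ (x, p) = f̃_x p̃ - p̃`, where `p̃` lies over `p`. Since `f̃_x` commutes
with integer translations, it does not matter which `p̃` is used. -/
noncomputable def disp (L : F.Lift) (q : (ℤ → X) × T2) : R2 :=
  L.fib q.1 (rep q.2) - rep q.2

/-- The set `D_n` of averaged displacements `(f̃^n_x p̃ - p̃) / n`. -/
noncomputable def avgDisp (L : F.Lift) (n : ℕ) : Set R2 :=
  {v | ∃ (x : ℤ → X) (p : R2), v = (n : ℝ)⁻¹ • (L.iter n x p - p)}

/-- The Misiurewicz-Ziemian rotation set of the lifted cocycle. -/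
noncomputable def rhoMZ (L : F.Lift) : Set R2 :=
  ⋂ N : ℕ, closure (⋃ n : ℕ, ⋃ _ : N ≤ n, L.avgDisp n)

variable [MeasurableSpace X]

/-- The rotation vector `∫ ρ₁ dm`. -/
noncomputable def rotVec (L : F.Lift) (m : Measure ((ℤ → X) × T2)) : R2 :=
  ∫ q, L.disp q ∂m

/-- The rotation set of a shift-invariant measure `μ`: the rotation vectors of the `F`-invariant
probability measures that project to `μ`. -/
noncomputable def rhoMeasure (L : F.Lift) (μ : Measure (ℤ → X)) : Set R2 :=
  L.rotVec '' F.fiberMeasures μ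

/-- The rotation set of the orbit of a single point of `X^ℤ`. -/
noncomputable def rhoOrbit (L : F.Lift) (x : ℤ → X) : Set R2 :=
  ⋃ μ ∈ orbitMeasures x, L.rhoMeasure μ

/-- The rotation set of periodic words. -/
noncomputable def rhoPer (L : F.Lift) : Set R2 :=
  ⋃ μ ∈ perMeasures X, L.rhoMeasure μ

end RCTH.Lift

end TorusCocycle

/-!
Both parts reduce to the equality of the rotation set of a periodic orbit with the rescaled rotation
set of `f̃^n_x`; the first part follows because an iterate of `f̃^n_x` is some `f̃^{nk}_x`.

*From the rotation set to measures.* A vector of `ρ(f̃^n_x)` is a limit of averaged displacements,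
that is, of Birkhoff averages of `ρ₁` along longer and longer orbit segments of `F` that start over
`x`. A limit of the corresponding empirical measures is an invariant measure with the right
rotation vector, carried by the (finite, hence closed) orbit of `x`
(`exists_invariant_integral_eq_limit`).

*From measures to the rotation set.* By invariance, `N` times the rotation vector of `m` is the
`m`-average of the displacements of `f̃^N_y`, `y` in the orbit of `x`. These differ by a constant
independent of `N` from displacements of `f̃^N_x`, so `N ρ(m)` is almost in the convex hull of the
displacements of `f̃^N_x`. It remains to see that this hull is within a bounded distance of the set
of displacements, with a bound independent of `N` (the theorem of Misiurewicz and Ziemian). The map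
`G = f̃^N_x` is injective and commutes with integer translations, so the image `K` of the unit square
has no integer chord of length at least `2`: no two points of `K` differ by such a vector.

*Coarse convexity* (`exists_norm_sub_lt_of_no_chord`). Suppose that `q`, in the convex hull of `K`,
is far from `K`. As the square is contractible, a continuous argument of `G z - q` can be chosen,
`z` in the square. For each direction `φ` let `x_φ` minimize `G` in this direction. As `q` is in the
hull, `G x_φ - q` points to the half-plane opposite to `φ`, so its chosen argument is
`φ + π + 2π m(φ)`, up to an error of about a right angle, for an integer `m(φ)`. Take an integer
vector `v` with `G x_φ + v` near `q` and `v` pointing to the half-plane of `φ`. It is long, hence not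
a chord, so that `G z - G y - v` also has a continuous argument, in `(y, z)`. If `x'` is a minimizer
for a direction close to `φ`, then `G x' - G y - v` stays in one open half-plane for all `y`, the
argument is constant on the diagonal, and for `y = x_φ` it differs little from that of `G z - q`.
Hence `x'` and `x_φ` have the same integer, and `m` is locally constant. But turning `φ` once around
replaces `m` by `m - 1`, a contradiction.
-/

namespace TorusCocycle

/-! ### Continuous arguments and coarse convexity -/

open Complex in
/-- A nowhere vanishing function on a contractible space has a continuous logarithm: a
null-homotopy of the identity is lifted through the covering `exp`. -/
theorem exists_continuous_log {A : Type*} [TopologicalSpace A] [ContractibleSpace A]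
    {f : A → ℂ} (hf : Continuous f) (h0 : ∀ a, f a ≠ 0) :
    ∃ ℓ : A → ℂ, Continuous ℓ ∧ ∀ a, exp (ℓ a) = f a := by
  obtain ⟨a₀, ⟨H⟩⟩ := id_nullhomotopic A
  let H' : C(unitInterval × A, {z : ℂ // z ≠ 0}) :=
    ⟨fun q => ⟨f (H.symm q), h0 _⟩, by fun_prop⟩
  have hH : ∀ a, H' (0, a) = ⟨exp (log (f a₀)), exp_ne_zero _⟩ := fun a =>
    Subtype.ext <| by simp [H', exp_log (h0 a₀)]
  let Γ := isCoveringMap_exp.liftHomotopy H' (.const A (log (f a₀))) hH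
  have hΓ := isCoveringMap_exp.liftHomotopy_lifts H' (.const A (log (f a₀))) hH
  refine ⟨fun a => Γ (1, a), by fun_prop, fun a => ?_⟩
  have := congrArg Subtype.val (congrFun hΓ (1, a))
  exact this.trans (by simp [H'])

theorem exists_int_abs_sub_le_pi (x : ℝ) : ∃ m : ℤ, |x - 2 * Real.pi * m| ≤ Real.pi := by
  refine ⟨round (x / (2 * Real.pi)), ?_⟩
  have hpi := Real.pi_pos
  have h := abs_sub_round (x / (2 * Real.pi))
  have : x - 2 * Real.pi * round (x / (2 * Real.pi))
      = (2 * Real.pi) * (x / (2 * Real.pi) - round (x / (2 * Real.pi))) := by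
    field_simp
  rw [this, abs_mul, abs_of_pos (by positivity)]
  nlinarith

/-- The error `s` allowed in `exists_norm_sub_lt_of_no_chord` makes the relevant cosine at least
`-1/2` instead of nonnegative. -/
theorem exists_int_abs_sub_le_of_neg_half_le_cos {x : ℝ} (hx : -(1 / 2) ≤ Real.cos x) :
    ∃ m : ℤ, |x - 2 * Real.pi * m| ≤ 2 * Real.pi / 3 := by
  obtain ⟨m, hm⟩ := exists_int_abs_sub_le_pi x
  refine ⟨m, ?_⟩
  by_contra! h
  have h1 := Real.strictAntiOn_cos ⟨by positivity, by linarith [Real.pi_pos]⟩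
    ⟨by positivity, hm⟩ h
  have h2 : Real.cos (2 * Real.pi / 3) = -(1 / 2) := by
    rw [show 2 * Real.pi / 3 = Real.pi - Real.pi / 3 by ring, Real.cos_pi_sub, Real.cos_pi_div_three]
  have h3 : Real.cos (x - 2 * Real.pi * m) = Real.cos x := by
    rw [mul_comm, Real.cos_sub_int_mul_two_pi]
  rw [Real.cos_abs, h2, h3] at h1
  linarith

/-- A continuous angle that stays in the open half-plane centred at the angle `c` stays in one
of the intervals of real angles representing this half-plane. -/
theorem exists_int_forall_abs_sub_lt {A : Type*} [TopologicalSpace A] [PreconnectedSpace A]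
    [Nonempty A] {θ : A → ℝ} (hθ : Continuous θ) {c : ℝ} (h : ∀ a, 0 < Real.cos (θ a - c)) :
    ∃ j : ℤ, ∀ a, |θ a - c - 2 * Real.pi * j| < Real.pi / 2 := by
  have hcos : ∀ (j : ℤ) a, 0 < Real.cos |θ a - c - 2 * Real.pi * j| := fun j a => by
    rw [Real.cos_abs, mul_comm, Real.cos_sub_int_mul_two_pi]; exact h a
  obtain ⟨a₀⟩ := ‹Nonempty A›
  obtain ⟨j, hj⟩ := exists_int_abs_sub_le_pi (θ a₀ - c)
  refine ⟨j, fun a => ?_⟩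
  by_contra! ha
  have hj' : |θ a₀ - c - 2 * Real.pi * j| ≤ Real.pi / 2 := by
    by_contra! h'
    exact (hcos j a₀).not_gt (Real.cos_neg_of_pi_div_two_lt_of_lt h' (by linarith [Real.pi_pos]))
  obtain ⟨b, hb⟩ := mem_range_of_exists_le_of_exists_ge
    (f := fun a => |θ a - c - 2 * Real.pi * j|) (by fun_prop) ⟨a₀, hj'⟩ ⟨a, ha⟩
  have := hcos j b
  rw [show |θ b - c - 2 * Real.pi * j| = Real.pi / 2 from hb, Real.cos_pi_div_two] at this
  exact this.false

theorem exp_mul_exp_neg_re (Z : ℂ) (φ : ℝ) :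
    (Complex.exp Z * Complex.exp (-(φ * Complex.I))).re = Real.exp Z.re * Real.cos (Z.im - φ) := by
  rw [← Complex.exp_add, Complex.exp_re]
  simp [sub_eq_add_neg]

/-- Perturbing a complex number by less than its modulus turns its argument by less than a right
angle. -/
theorem cos_im_sub_pos_of_norm_lt {A B w u : ℂ} (hA : Complex.exp A = w + u)
    (hB : Complex.exp B = w) (h : ‖u‖ < ‖w‖) : 0 < Real.cos (A.im - B.im) := by
  have hw : w ≠ 0 := norm_pos_iff.1 ((norm_nonneg u).trans_lt h)
  have h1 : Complex.exp (A - B) = 1 + u / w := by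
    rw [Complex.exp_sub, hA, hB]; field_simp
  have h2 : 0 < (Complex.exp (A - B)).re := by
    rw [h1, Complex.add_re, Complex.one_re]
    have h3 := Complex.abs_re_le_norm (u / w)
    have h4 : ‖u / w‖ < 1 := by
      rw [norm_div]; exact (div_lt_one (norm_pos_iff.2 hw)).2 h
    linarith [(abs_le.1 h3).1]
  rw [Complex.exp_re, Complex.sub_im] at h2
  exact pos_of_mul_pos_right h2 (Real.exp_pos _).le

theorem int_eq_zero_of_abs_two_pi_mul_lt {k : ℤ} (h : |2 * Real.pi * k| < 2 * Real.pi) : k = 0 := by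
  have hpi := Real.pi_pos
  rw [abs_mul, abs_of_pos (by positivity : (0:ℝ) < 2 * Real.pi)] at h
  have h1 : |(k : ℝ)| < 1 := by
    by_contra! h'
    nlinarith
  rw [← Int.abs_lt_one_iff]
  exact_mod_cast h1

/-- **Coarse convexity of a set without long lattice chords.** Let `g` be continuous on a compact
contractible space and let `Λ` be a `1`-dense set of vectors, none of which, from length `R` on, is
a difference of two values of `g`. Then every `q` that lies, up to an error `s`, in the convex hull
of the image of `g` is within `R + 2 s + 4` of the image. Being in the convex hull is expressed by
half-planes: `Re (w e^{-iφ})` is the component of `w` in the direction `φ`. -/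
theorem exists_norm_sub_lt_of_no_chord {P : Type*} [TopologicalSpace P] [CompactSpace P]
    [ContractibleSpace P] {g : P → ℂ} (hg : Continuous g) {Λ : Set ℂ}
    (hΛ : ∀ c, ∃ v ∈ Λ, ‖v - c‖ ≤ 1) {R s : ℝ} (hR : 0 ≤ R) (hs : 0 ≤ s)
    (hchord : ∀ v ∈ Λ, R ≤ ‖v‖ → ∀ y z, g z - g y ≠ v) (q : ℂ)
    (hq : ∀ φ : ℝ, ∃ z, ((g z - q) * Complex.exp (-(φ * Complex.I))).re ≤ s) :
    ∃ z, ‖g z - q‖ < R + 2 * s + 4 := by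
  by_contra! hfar
  have hpi := Real.pi_pos
  obtain ⟨ℓ, hℓc, hℓ⟩ := exists_continuous_log (f := fun z => g z - q) (by fun_prop)
    (fun z h => by have := hfar z; rw [h, norm_zero] at this; linarith)
  have hmin : ∀ c : ℂ, ∃ x, ∀ z, (g x * c).re ≤ (g z * c).re := fun c => by
    obtain ⟨x, -, hx⟩ := isCompact_univ.exists_isMinOn (univ_nonempty (α := P))
      (f := fun z => (g z * c).re) (by fun_prop)
    exact ⟨x, fun z => hx (mem_univ z)⟩
  choose ξ hξ using hmin
  let e : ℝ → ℂ := fun φ => Complex.exp (-(φ * Complex.I))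
  have he : ∀ φ, ‖e φ‖ = 1 := fun φ => by
    simp only [e]; rw [← neg_mul, ← Complex.ofReal_neg, Complex.norm_exp_ofReal_mul_I]
  have hlow : ∀ φ, ((g (ξ (e φ)) - q) * e φ).re ≤ s := fun φ => by
    obtain ⟨z, hz⟩ := hq φ
    have := hξ (e φ) z
    simp only [sub_mul, Complex.sub_re] at hz ⊢
    exact (sub_le_sub_right this _).trans hz
  have hm : ∀ φ : ℝ, ∃ m : ℤ,
      |(ℓ (ξ (e φ))).im - φ - Real.pi - 2 * Real.pi * m| ≤ 2 * Real.pi / 3 := fun φ => by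
    apply exists_int_abs_sub_le_of_neg_half_le_cos
    rw [Real.cos_sub_pi]
    have h1 := hlow φ
    rw [← hℓ, exp_mul_exp_neg_re, ← Complex.norm_exp, hℓ] at h1
    have h2 := hfar (ξ (e φ))
    by_contra! h3
    nlinarith
  choose m hm using hm
  -- `m φ` counts the turns of the chosen argument of `g - q` at the minimum in direction `φ`
  have hloc : IsLocallyConstant m := by
    rw [IsLocallyConstant.iff_eventually_eq]
    intro φ₀
    set x₀ := ξ (e φ₀)
    -- the term `(s + 2) e^{iφ₀}` beats the errors `s` and `1`, so `v` points in the direction `φ₀`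
    obtain ⟨v, hvΛ, hv⟩ := hΛ (q - g x₀ + (s + 2) * (e φ₀)⁻¹)
    have he0 : e φ₀ ≠ 0 := Complex.exp_ne_zero _
    have hvpos : 0 < (v * e φ₀).re := by
      have h1 : v * e φ₀ = (v - (q - g x₀ + (s + 2) * (e φ₀)⁻¹)) * e φ₀
          - (g x₀ - q) * e φ₀ + (s + 2) := by field_simp; ring
      have h2 := Complex.abs_re_le_norm ((v - (q - g x₀ + (s + 2) * (e φ₀)⁻¹)) * e φ₀)
      rw [norm_mul, he, mul_one] at h2
      have h3 := hlow φ₀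
      rw [h1]
      simp only [Complex.add_re, Complex.sub_re, Complex.ofReal_re, Complex.re_ofNat] at *
      linarith [(abs_le.1 h2).1]
    have hvq : ‖q - g x₀ - v‖ ≤ s + 3 := by
      have h1 : q - g x₀ - v = -(v - (q - g x₀ + (s + 2) * (e φ₀)⁻¹)) - (s + 2) * (e φ₀)⁻¹ := by ring
      rw [h1]
      refine (norm_sub_le _ _).trans ?_
      have h2 : ‖((s : ℂ) + 2) * (e φ₀)⁻¹‖ = s + 2 := by
        rw [norm_mul, norm_inv, he, inv_one, mul_one, ← Complex.ofReal_ofNat, ← Complex.ofReal_add,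
          Complex.norm_real, Real.norm_of_nonneg (by linarith)]
      rw [norm_neg, h2]; linarith
    have hvR : R ≤ ‖v‖ := by
      have h1 := hfar x₀
      have h2 := norm_sub_norm_le (q - g x₀) v
      rw [norm_sub_rev] at h1
      linarith
    obtain ⟨Θ, hΘc, hΘ⟩ := exists_continuous_log (A := P × P)
      (f := fun w => g w.2 - g w.1 - v) (by fun_prop)
      (fun w h => hchord v hvΛ hvR w.1 w.2 (sub_eq_zero.1 h))
    have hev : ∀ᶠ φ in nhds φ₀, 0 < (v * e φ).re := by
      have : Continuous fun φ : ℝ => (v * e φ).re := by fun_prop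
      exact this.continuousAt.eventually (lt_mem_nhds hvpos)
    have hev' : ∀ᶠ φ in nhds φ₀, |φ - φ₀| < Real.pi / 3 := by
      have : Continuous fun φ : ℝ => |φ - φ₀| := by fun_prop
      exact this.continuousAt.eventually (gt_mem_nhds (by simpa using by positivity))
    filter_upwards [hev, hev'] with φ hφ hφ'
    set x := ξ (e φ)
    -- `g x - g w - v` stays in the open half-plane below the direction `φ`, for all `w`
    obtain ⟨κ, hκ⟩ := exists_int_forall_abs_sub_lt (θ := fun w => (Θ (w, x)).im) (c := φ + Real.pi)
      (by fun_prop) (fun w => by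
        rw [← sub_sub, Real.cos_sub_pi]
        have h1 : ((g x - g w - v) * e φ).re < 0 := by
          have := hξ (e φ) w
          simp only [sub_mul, Complex.sub_re]
          linarith
        rw [← hΘ (w, x), exp_mul_exp_neg_re] at h1
        have := Real.exp_pos (Θ (w, x)).re
        by_contra! h2
        nlinarith)
    -- `g z - g x₀ - v` is a small perturbation of `g z - q`, for all `z`
    obtain ⟨j, hj⟩ := exists_int_forall_abs_sub_lt (θ := fun z => (Θ (x₀, z)).im - (ℓ z).im) (c := 0)
      (by fun_prop) (fun z => by
        rw [sub_zero]
        refine cos_im_sub_pos_of_norm_lt (w := g z - q) (u := q - g x₀ - v) ?_ (hℓ z) ?_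
        · rw [hΘ]; ring
        · have := hfar z; linarith)
    -- on the diagonal `Θ` is a logarithm of the constant `-v`
    have hdiag : (Θ (x, x)).im = (Θ (x₀, x₀)).im := by
      have hd : ∀ z, Real.cos ((Θ (z, z)).im - (Θ (x₀, x₀)).im) = 1 := fun z => by
        have h1 : Complex.exp (Θ (z, z) - Θ (x₀, x₀)) = 1 := by
          rw [Complex.exp_sub, hΘ, hΘ]; simp only [sub_self]
          exact div_self (fun h => hchord v hvΛ hvR x x (by linear_combination h))
        have h2 : Θ (z, z) - Θ (x₀, x₀) = ((Θ (z, z)).im - (Θ (x₀, x₀)).im : ℝ) * Complex.I := by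
          obtain ⟨n, hn⟩ := Complex.exp_eq_one_iff.1 h1
          apply Complex.ext
          · rw [hn]; simp
          · simp
        rw [h2] at h1
        have h3 := congrArg Complex.re h1
        rwa [Complex.exp_ofReal_mul_I_re] at h3
      obtain ⟨i, hi⟩ := exists_int_forall_abs_sub_lt (θ := fun z => (Θ (z, z)).im)
        (c := (Θ (x₀, x₀)).im) (by fun_prop) (fun z => by rw [hd]; exact one_pos)
      have hi0 := hi x₀
      obtain rfl : i = 0 := int_eq_zero_of_abs_two_pi_mul_lt (by
        rw [sub_self, zero_sub, abs_neg] at hi0; linarith)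
      have h4 := hi x
      simp only [Int.cast_zero, mul_zero, sub_zero] at h4
      have h5 := abs_lt.1 h4
      exact sub_eq_zero.1 ((Real.cos_eq_one_iff_of_lt_of_lt (by linarith) (by linarith)).1 (hd x))
    have a1 := abs_lt.1 (hκ x₀)
    have a2 := abs_lt.1 (hκ x)
    have a3 := abs_lt.1 (hj x₀)
    have a4 := abs_lt.1 (hj x)
    have a5 := abs_le.1 (hm φ)
    have a6 := abs_le.1 (hm φ₀)
    have a7 := abs_lt.1 hφ'
    have b1 : κ - j - m φ = 0 := int_eq_zero_of_abs_two_pi_mul_lt (by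
      push_cast; rw [abs_lt]; constructor <;> linarith)
    have b2 : κ - j - m φ₀ = 0 := int_eq_zero_of_abs_two_pi_mul_lt (by
      push_cast; rw [abs_lt]; constructor <;> linarith)
    omega
  -- one full turn of `φ` changes the argument by `2π` but not the minimizer
  have h1 : m (2 * Real.pi) = m 0 := hloc.apply_eq_of_preconnectedSpace _ _
  have h2 : e (2 * Real.pi) = e 0 := by
    simp only [e]
    rw [Complex.exp_eq_exp_iff_exists_int]
    exact ⟨-1, by push_cast; ring⟩
  have h3 := abs_le.1 (hm (2 * Real.pi))
  have h4 := abs_le.1 (hm 0)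
  rw [h2, h1] at h3
  linarith

/-! ### Lifts and displacements -/

/-- An integer vector as a vector of the plane. -/
def intVec (v : Fin 2 → ℤ) : R2 := fun i => (v i : ℝ)

theorem proj_eq_proj_iff {p q : R2} : proj p = proj q ↔ ∃ v : Fin 2 → ℤ, p = q + intVec v := by
  have key : ∀ i, (p i : UnitAddCircle) = (q i : UnitAddCircle) ↔ ∃ n : ℤ, p i = q i + n := by
    intro i
    rw [← sub_eq_zero, ← AddCircle.coe_sub, AddCircle.coe_eq_zero_iff]
    constructor
    · rintro ⟨n, hn⟩
      exact ⟨n, by rw [zsmul_eq_mul, mul_one] at hn; linarith⟩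
    · rintro ⟨n, hn⟩
      exact ⟨n, by rw [zsmul_eq_mul, mul_one]; linarith⟩
  constructor
  · intro h
    choose v hv using fun i => (key i).1 (congrFun h i)
    exact ⟨v, funext hv⟩
  · rintro ⟨v, rfl⟩
    funext i
    exact (key i).2 ⟨v i, rfl⟩

theorem isOpenQuotientMap_proj : IsOpenQuotientMap proj :=
  IsOpenQuotientMap.piMap (f := fun (_ : Fin 2) (t : ℝ) => (t : UnitAddCircle))
    fun _ => QuotientAddGroup.isOpenQuotientMap_mk

theorem rep_mem_Icc (p : T2) : rep p ∈ Icc (0 : R2) 1 := by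
  have h := fun i => (AddCircle.equivIco (1 : ℝ) 0 (p i)).2
  exact ⟨fun i => (h i).1, fun i => (h i).2.le.trans_eq (zero_add 1)⟩

theorem continuous_shift {X : Type*} [TopologicalSpace X] : Continuous (shift (X := X)) :=
  continuous_pi fun k => continuous_apply (k + 1)

theorem RCTH.continuous_map {X : Type*} [TopologicalSpace X] (F : RCTH X) : Continuous F.map :=
  (continuous_shift.comp continuous_fst).prodMk F.continuous_fib

theorem RCTH.fst_map_iterate {X : Type*} [TopologicalSpace X] (F : RCTH X) (n : ℕ)
    (q : (ℤ → X) × T2) : (F.map^[n] q).1 = shift^[n] q.1 := by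
  induction n with
  | zero => rfl
  | succ n ih => rw [Function.iterate_succ_apply', Function.iterate_succ_apply', ← ih]; rfl

namespace RCTH.Lift

variable {X : Type*} [TopologicalSpace X] {F : RCTH X} (L : F.Lift)

theorem continuous_fib_apply (x : ℤ → X) : Continuous (L.fib x) :=
  L.continuous_fib.comp (Continuous.prodMk_right x)

/-- Lifts of a torus homeomorphism homotopic to the identity commute with the integer
translations: the displacement `f_x - id` is null-homotopic, so it lifts to a map `𝕋² → ℝ²`, from
which `f̃_x - id` differs by a constant. -/
theorem fib_add_intVec (x : ℤ → X) (p : R2) (v : Fin 2 → ℤ) :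
    L.fib x (p + intVec v) = L.fib x p + intVec v := by
  obtain ⟨H⟩ := F.homotopic_id x
  funext i
  let K : C(unitInterval × T2, UnitAddCircle) := ⟨fun q => H.symm q i - q.2 i, by fun_prop⟩
  have cov : IsCoveringMap ((↑) : ℝ → UnitAddCircle) := AddCircle.isCoveringMap_coe 1
  have hK : ∀ a, K (0, a) = (((ContinuousMap.const T2 (0 : ℝ)) a : ℝ) : UnitAddCircle) := fun a => by
    simp [K]
  let Γ := cov.liftHomotopy K (.const T2 0) hK
  have hΓ : ∀ a : T2, ((Γ (1, a) : ℝ) : UnitAddCircle) = F.fib x a i - a i := fun a =>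
    (congrFun (cov.liftHomotopy_lifts K (.const T2 0) hK) (1, a)).trans (by simp [K])
  have hproj : Continuous proj := isOpenQuotientMap_proj.continuous
  have hLc := L.continuous_fib_apply x
  have h0 : ∀ p : R2, ((L.fib x p i - p i - Γ (1, proj p) : ℝ) : UnitAddCircle) = 0 := fun p => by
    rw [AddCircle.coe_sub, AddCircle.coe_sub, hΓ, ← L.proj_fib]
    exact sub_self _
  have hc := cov.const_of_comp (A := R2) (g := fun p : R2 => L.fib x p i - p i - Γ (1, proj p))
    (by fun_prop) (fun p q => (h0 p).trans (h0 q).symm) (p + intVec v) p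
  have hpv : proj (p + intVec v) = proj p := proj_eq_proj_iff.2 ⟨v, rfl⟩
  simp only [hpv, Pi.add_apply] at hc ⊢
  linarith

theorem fib_injective (x : ℤ → X) : Function.Injective (L.fib x) := by
  intro p q h
  have h1 : proj p = proj q := (F.fib x).injective (by rw [← L.proj_fib, ← L.proj_fib, h])
  obtain ⟨v, rfl⟩ := proj_eq_proj_iff.1 h1
  rw [fib_add_intVec] at h
  rw [add_eq_left.1 h, add_zero]

theorem continuous_iter (n : ℕ) (x : ℤ → X) : Continuous (L.iter n x) := by
  induction n with
  | zero => exact continuous_id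
  | succ n ih => exact (L.continuous_fib_apply _).comp ih

theorem iter_injective (n : ℕ) (x : ℤ → X) : Function.Injective (L.iter n x) := by
  induction n with
  | zero => exact Function.injective_id
  | succ n ih => exact (L.fib_injective _).comp ih

theorem iter_add_intVec (n : ℕ) (x : ℤ → X) (p : R2) (v : Fin 2 → ℤ) :
    L.iter n x (p + intVec v) = L.iter n x p + intVec v := by
  induction n with
  | zero => rfl
  | succ n ih => simp only [iter, ih, fib_add_intVec]

theorem iterate_iter {n : ℕ} {x : ℤ → X} (hx : Function.IsPeriodicPt shift n x) (k : ℕ) (p : R2) :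
    (L.iter n x)^[k] p = L.iter (n * k) x p := by
  have key : L.map^[n * k] (x, p) = (x, (L.iter n x)^[k] p) := by
    rw [Function.iterate_mul]
    induction k with
    | zero => rfl
    | succ k ih => rw [Function.iterate_succ_apply', ih, map_iterate, Function.iterate_succ_apply',
        hx.eq]
  rw [map_iterate] at key
  exact (congrArg Prod.snd key).symm

theorem disp_proj (x : ℤ → X) (p : R2) : L.disp (x, proj p) = L.fib x p - p := by
  obtain ⟨v, hv⟩ := proj_eq_proj_iff.1 (proj_rep (proj p))
  simp only [disp, hv, fib_add_intVec, add_sub_add_right_eq_sub]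

theorem continuous_disp : Continuous L.disp := by
  rw [← (IsOpenQuotientMap.id.prodMap isOpenQuotientMap_proj).continuous_comp_iff]
  have : L.disp ∘ Prod.map id proj = fun q => L.fib q.1 q.2 - q.2 :=
    funext fun q => L.disp_proj q.1 q.2
  rw [this]
  exact L.continuous_fib.sub continuous_snd

theorem map_iterate_proj (n : ℕ) (x : ℤ → X) (p : R2) :
    F.map^[n] (x, proj p) = (shift^[n] x, proj (L.iter n x p)) := by
  induction n with
  | zero => rfl
  | succ n ih =>
    rw [Function.iterate_succ_apply', ih, Function.iterate_succ_apply', iter, proj_fib]; rfl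

theorem birkhoffSum_disp (n : ℕ) (x : ℤ → X) (p : R2) :
    birkhoffSum F.map L.disp n (x, proj p) = L.iter n x p - p := by
  induction n with
  | zero => simp [iter]
  | succ n ih =>
    rw [birkhoffSum_succ, ih, map_iterate_proj L, disp_proj, iter]
    abel

theorem exists_norm_disp_le [CompactSpace X] : ∃ M, 0 ≤ M ∧ ∀ q, ‖L.disp q‖ ≤ M := by
  obtain ⟨M, hM⟩ := isCompact_univ.exists_bound_of_continuousOn L.continuous_disp.continuousOn
  exact ⟨max M 0, le_max_right _ _, fun q => (hM q (mem_univ q)).trans (le_max_left _ _)⟩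

end RCTH.Lift

/-! ### Coarse convexity of displacements -/

/-- The linear functional `v ↦ ⟨v, (cos φ, sin φ)⟩` on the plane. -/
noncomputable def dirFun (φ : ℝ) : R2 →L[ℝ] ℝ :=
  Real.cos φ • ContinuousLinearMap.proj 0 + Real.sin φ • ContinuousLinearMap.proj 1

theorem dirFun_apply (φ : ℝ) (v : R2) : dirFun φ v = Real.cos φ * v 0 + Real.sin φ * v 1 := rfl

theorem abs_dirFun_le (φ : ℝ) (v : R2) : |dirFun φ v| ≤ 2 * ‖v‖ := by
  rw [dirFun_apply]
  refine (abs_add_le _ _).trans ?_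
  rw [abs_mul, abs_mul]
  have h0 := norm_le_pi_norm v 0
  have h1 := norm_le_pi_norm v 1
  rw [Real.norm_eq_abs] at h0 h1
  have h2 := mul_le_mul (Real.abs_cos_le_one φ) h0 (abs_nonneg _) zero_le_one
  have h3 := mul_le_mul (Real.abs_sin_le_one φ) h1 (abs_nonneg _) zero_le_one
  linarith

/-- The identification of the plane with `ℂ`. -/
noncomputable def toComplex (v : R2) : ℂ := ⟨v 0, v 1⟩

theorem continuous_toComplex : Continuous toComplex := by
  have : toComplex = fun v => Complex.equivRealProdCLM.symm (v 0, v 1) := by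
    funext v; apply Complex.ext <;> simp [toComplex]
  rw [this]; fun_prop

theorem toComplex_sub (v w : R2) : toComplex (v - w) = toComplex v - toComplex w := rfl

theorem norm_le_norm_toComplex (v : R2) : ‖v‖ ≤ ‖toComplex v‖ := by
  refine (pi_norm_le_iff_of_nonneg (norm_nonneg _)).2 fun i => ?_
  fin_cases i
  · exact Complex.abs_re_le_norm (toComplex v)
  · exact Complex.abs_im_le_norm (toComplex v)

theorem toComplex_mul_exp_re (φ : ℝ) (v : R2) :
    (toComplex v * Complex.exp (-(φ * Complex.I))).re = dirFun φ v := by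
  rw [← neg_mul, ← Complex.ofReal_neg, Complex.mul_re, Complex.exp_ofReal_mul_I_re,
    Complex.exp_ofReal_mul_I_im, dirFun_apply, Real.cos_neg, Real.sin_neg]
  simp only [toComplex]; ring

/-- **Coarse convexity of the set of displacements.** Let `G` be a continuous injective map of the
plane that commutes with the integer translations. A point that lies, up to an error `s`, in all
half-planes containing the displacements of `G` is within `2 s + 11` of a displacement. The point is
that the image of the unit square has no long integer chords. -/
theorem exists_norm_displacement_sub_le {G : R2 → R2} (hc : Continuous G)
    (hinj : Function.Injective G) (hG : ∀ p v, G (p + intVec v) = G p + intVec v)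
    {s : ℝ} (hs : 0 ≤ s) (q : R2) (hq : ∀ φ, ∃ p, dirFun φ (G p - p - q) ≤ s) :
    ∃ p, ‖G p - p - q‖ ≤ 2 * s + 11 := by
  have : ContractibleSpace (Icc (0 : R2) 1) :=
    (convex_Icc (0 : R2) 1).contractibleSpace ⟨0, by simp⟩
  have hbd : ∀ z : Icc (0 : R2) 1, ‖(z : R2)‖ ≤ 1 := fun z =>
    (pi_norm_le_iff_of_nonneg zero_le_one).2 fun i =>
      abs_le.2 ⟨by have := z.2.1 i; simp at this; linarith, z.2.2 i⟩
  have key := exists_norm_sub_lt_of_no_chord (P := Icc (0 : R2) 1)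
    (g := fun z => toComplex (G z)) (continuous_toComplex.comp (hc.comp continuous_subtype_val))
    (Λ := range fun v => toComplex (intVec v)) (R := 2) (s := s + 2)
    (fun c => by
      refine ⟨_, ⟨![round c.re, round c.im], rfl⟩, ?_⟩
      refine (Complex.norm_le_abs_re_add_abs_im _).trans ?_
      have h1 := abs_sub_round c.re
      have h2 := abs_sub_round c.im
      rw [abs_sub_comm] at h1 h2
      simpa [toComplex, intVec] using (add_le_add h1 h2).trans (by norm_num))
    zero_le_two (by linarith) ?_ (toComplex q) ?_
  · obtain ⟨z, hz⟩ := key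
    refine ⟨z, ?_⟩
    have h1 := norm_le_norm_toComplex (G z - q)
    rw [toComplex_sub] at h1
    have h2 := norm_sub_le (G z - q) z
    rw [sub_right_comm]
    linarith [hbd z]
  · -- an integer chord of the image of the square comes from an integer chord of the square
    rintro _ ⟨v, rfl⟩ hv y z h
    have h1 : G z = G (y + intVec v) := by
      rw [hG]
      rw [← toComplex_sub] at h
      have h2 : G z - G y = intVec v := by
        funext i
        fin_cases i
        · exact congrArg Complex.re h
        · exact congrArg Complex.im h
      rw [← h2]; abel
    have h2 : ∀ i, |intVec v i| ≤ 1 := fun i => by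
      have h3 := congrFun (hinj h1) i
      have := y.2.1 i; have := y.2.2 i; have := z.2.1 i; have := z.2.2 i
      simp only [Pi.zero_apply, Pi.one_apply, Pi.add_apply] at *
      rw [abs_le]; constructor <;> linarith
    have h3 := Complex.sq_norm (toComplex (intVec v))
    rw [Complex.normSq_apply] at h3
    have h4 := abs_le.1 (h2 0)
    have h5 := abs_le.1 (h2 1)
    simp only [toComplex] at h3 hv
    nlinarith
  · intro φ
    obtain ⟨p, hp⟩ := hq φ
    refine ⟨⟨rep (proj p), rep_mem_Icc _⟩, ?_⟩
    obtain ⟨v, hv⟩ := proj_eq_proj_iff.1 (proj_rep (proj p))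
    rw [← toComplex_sub, toComplex_mul_exp_re]
    have h1 : G (rep (proj p)) - q = (G p - p - q) + rep (proj p) := by
      rw [hv, hG]; abel
    have h2 := hbd ⟨rep (proj p), rep_mem_Icc _⟩
    have h3 := abs_le.1 (abs_dirFun_le φ (rep (proj p)))
    simp only [h1, map_add]
    simp only at h2
    linarith

/-! ### Rotation vectors of invariant measures -/

theorem norm_birkhoffSum_iterate_sub_le {α E : Type*} [SeminormedAddCommGroup E] {T : α → α}
    {f : α → E} {M : ℝ} (hf : ∀ q, ‖f q‖ ≤ M) (N j : ℕ) (q : α) :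
    ‖birkhoffSum T f N (T^[j] q) - birkhoffSum T f N q‖ ≤ 2 * M * j := by
  induction j with
  | zero => simp
  | succ j ih =>
    have h1 := birkhoffSum_apply_sub_birkhoffSum T f N (T^[j] q)
    have h2 : ‖birkhoffSum T f N (T (T^[j] q)) - birkhoffSum T f N (T^[j] q)‖ ≤ 2 * M := by
      rw [h1]
      refine (norm_sub_le _ _).trans ?_
      linarith [hf (T^[N] (T^[j] q)), hf (T^[j] q)]
    rw [Function.iterate_succ_apply']
    refine (norm_sub_le_norm_sub_add_norm_sub _ (birkhoffSum T f N (T^[j] q)) _).trans ?_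
    push_cast
    linarith

theorem integral_birkhoffSum {α E : Type*} [MeasurableSpace α] [NormedAddCommGroup E]
    [NormedSpace ℝ E] {m : Measure α} {T : α → α} (hT : MeasurePreserving T m m) {f : α → E}
    (hf : Integrable f m) (N : ℕ) : ∫ q, birkhoffSum T f N q ∂m = (N : ℝ) • ∫ q, f q ∂m := by
  have h1 : ∀ j, ∫ q, f (T^[j] q) ∂m = ∫ q, f q ∂m := fun j => by
    have h := hT.iterate j
    have h' := integral_map (μ := m) h.measurable.aemeasurable (f := f)
      (by rw [h.map_eq]; exact hf.aestronglyMeasurable)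
    rw [h.map_eq] at h'
    exact h'.symm
  have h2 : ∀ j, Integrable (fun q => f (T^[j] q)) m := fun j =>
    (hT.iterate j).integrable_comp_of_integrable hf
  simp only [birkhoffSum]
  rw [integral_finsetSum _ fun j _ => h2 j]
  simp [h1, Nat.cast_smul_eq_nsmul]

theorem exists_iterate_iterate_eq {α : Type*} {f : α → α} {x : α} {n : ℕ} (hn : 0 < n)
    (hx : Function.IsPeriodicPt f n x) (k : ℕ) : ∃ j ≤ n, f^[j] (f^[k] x) = x := by
  refine ⟨n - k % n, Nat.sub_le _ _, ?_⟩
  rw [← Function.iterate_add_apply]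
  have : n ∣ n - k % n + k := by
    have h1 := Nat.mod_lt k hn
    have h2 := Nat.div_add_mod k n
    exact ⟨1 + k / n, by rw [mul_add]; omega⟩
  exact (hx.trans_dvd this).eq

namespace RCTH.Lift

variable {X : Type*} [MetricSpace X] [CompactSpace X] [MeasurableSpace X] [BorelSpace X]
  {F : RCTH X} (L : F.Lift)

theorem integrable_disp (m : Measure ((ℤ → X) × T2)) [IsFiniteMeasure m] : Integrable L.disp m := by
  obtain ⟨M, -, hM⟩ := L.exists_norm_disp_le
  exact .of_bound L.continuous_disp.aestronglyMeasurable M (ae_of_all _ hM)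

/-- The rotation vector of an invariant measure over a periodic orbit is an average of
displacements of `f̃^N_x`, up to the error made by moving along the orbit to the fibre of `x`; so
coarse convexity puts it close to a single displacement, uniformly in `N`. -/
theorem exists_norm_iter_sub_le {x : ℤ → X} {n : ℕ} (hn : 0 < n)
    (hx : Function.IsPeriodicPt shift n x) {m : Measure ((ℤ → X) × T2)} (hm : m ∈ invMeasures F.map)
    (hsupp : ∀ᵐ q ∂m, q.1 ∈ range fun k : ℕ => shift^[k] x) :
    ∃ C, ∀ N : ℕ, ∃ p, ‖L.iter N x p - p - (N : ℝ) • L.rotVec m‖ ≤ C := by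
  obtain ⟨hprob, hinv⟩ := hm
  obtain ⟨M, hM0, hM⟩ := L.exists_norm_disp_le
  refine ⟨2 * (4 * M * n + 1) + 11, fun N => ?_⟩
  refine exists_norm_displacement_sub_le (L.continuous_iter N x) (L.iter_injective N x)
    (fun p v => L.iter_add_intVec N x p v) (by positivity) _ fun φ => ?_
  -- otherwise the Birkhoff sums minus their mean `V` have component at least `1` in direction `φ`
  by_contra! hcon
  set V := (N : ℝ) • L.rotVec m
  have hint : Integrable (birkhoffSum F.map L.disp N) m := by
    refine integrable_finsetSum _ fun j _ => ?_
    exact (hinv.iterate j).integrable_comp_of_integrable (L.integrable_disp m)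
  have hle : ∀ᵐ q ∂m, 1 ≤ dirFun φ (birkhoffSum F.map L.disp N q - V) := by
    filter_upwards [hsupp] with q hq
    obtain ⟨k, hk⟩ := hq
    obtain ⟨j, hj, hjk⟩ := exists_iterate_iterate_eq hn hx k
    set q' := F.map^[j] q with hq'
    have hq1 : q' = (x, proj (rep q'.2)) := by
      rw [proj_rep]
      refine Prod.ext ?_ rfl
      rw [hq', F.fst_map_iterate, ← hk]
      exact hjk
    have h1 := norm_birkhoffSum_iterate_sub_le (T := F.map) hM N j q
    rw [← hq'] at h1
    have h2 : birkhoffSum F.map L.disp N q' = L.iter N x (rep q'.2) - rep q'.2 := by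
      rw [← L.birkhoffSum_disp, ← hq1]
    have h3 := hcon (rep q'.2)
    rw [← h2] at h3
    have h4 := abs_le.1 (abs_dirFun_le φ (birkhoffSum F.map L.disp N q' - birkhoffSum F.map L.disp N q))
    have h5 : 2 * M * j ≤ 2 * M * n := by gcongr
    rw [map_sub] at h3 h4 ⊢
    linarith [h4.2]
  have h6 : ∫ q, dirFun φ (birkhoffSum F.map L.disp N q - V) ∂m = 0 := by
    have h := (dirFun φ).integral_comp_comm (hint.sub (integrable_const V))
    simp only [Pi.sub_apply] at h
    rw [h, integral_sub hint (integrable_const V), integral_birkhoffSum hinv (L.integrable_disp m)]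
    simp [V, rotVec]
  have h7 : ∫ _, (1 : ℝ) ∂m ≤ ∫ q, dirFun φ (birkhoffSum F.map L.disp N q - V) ∂m :=
    integral_mono_ae (integrable_const _)
      ((dirFun φ).integrable_comp (hint.sub (integrable_const V))) hle
  rw [h6] at h7
  simp at h7
  linarith

/-- Dividing by `N = n k`, the bounded error of `exists_norm_iter_sub_le` disappears as `k → ∞`. -/
theorem smul_rotVec_mem_planeRotationSet {x : ℤ → X} {n : ℕ} (hn : 0 < n)
    (hx : Function.IsPeriodicPt shift n x) {m : Measure ((ℤ → X) × T2)} (hm : m ∈ invMeasures F.map)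
    (hsupp : ∀ᵐ q ∂m, q.1 ∈ range fun k : ℕ => shift^[k] x) :
    (n : ℝ) • L.rotVec m ∈ planeRotationSet (L.iter n x) := by
  obtain ⟨C, hC⟩ := L.exists_norm_iter_sub_le hn hx hm hsupp
  refine mem_iInter.2 fun N => Metric.mem_closure_iff.2 fun ε hε => ?_
  obtain ⟨k₀, hk₀⟩ := exists_nat_gt (C / ε)
  set k := max (max N k₀) 1 with hk
  have hkpos : (0 : ℝ) < k := by
    have : 1 ≤ k := le_max_right _ _
    exact_mod_cast this
  have hkk : (k₀ : ℝ) ≤ k := by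
    have : k₀ ≤ k := (le_max_right _ _).trans (le_max_left _ _)
    exact_mod_cast this
  obtain ⟨p, hp⟩ := hC (n * k)
  refine ⟨(k : ℝ)⁻¹ • ((L.iter n x)^[k] p - p), mem_iUnion₂.2
    ⟨k, (le_max_left _ _).trans (le_max_left _ _), p, rfl⟩, ?_⟩
  rw [L.iterate_iter hx, dist_comm, dist_eq_norm]
  have h1 : (k : ℝ)⁻¹ • (L.iter (n * k) x p - p) - (n : ℝ) • L.rotVec m
      = (k : ℝ)⁻¹ • (L.iter (n * k) x p - p - ((n * k : ℕ) : ℝ) • L.rotVec m) := by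
    rw [smul_sub (k : ℝ)⁻¹ (L.iter (n * k) x p - p), smul_smul]
    congr 2
    push_cast
    field_simp
  rw [h1, norm_smul, norm_inv, Real.norm_of_nonneg hkpos.le, inv_mul_lt_iff₀ hkpos]
  rw [div_lt_iff₀ hε] at hk₀
  nlinarith

end RCTH.Lift

/-! ### Construction of invariant measures -/

open Filter Topology in
/-- **Krylov–Bogoliubov**: the empirical measures along ever longer orbit segments accumulate at an
invariant measure, whose integrals are the limits of the Birkhoff averages that converge. -/
theorem exists_invariant_integral_eq_limit {α : Type*} [TopologicalSpace α] [CompactSpace α]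
    [TopologicalSpace.MetrizableSpace α] [MeasurableSpace α] [BorelSpace α] {T : α → α}
    (hT : Continuous T) (y : ℕ → α) {M : ℕ → ℕ} (hM0 : ∀ k, 0 < M k) (hM : Tendsto M atTop atTop) :
    ∃ m ∈ invMeasures T, ∀ f : α → ℝ, Continuous f → ∀ c,
      Tendsto (fun k => (M k : ℝ)⁻¹ * birkhoffSum T f (M k) (y k)) atTop (𝓝 c) →
        ∫ q, f q ∂m = c := by
  let ν : ℕ → Measure α := fun k =>
    (M k : ENNReal)⁻¹ • ∑ j ∈ Finset.range (M k), Measure.dirac (T^[j] (y k))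
  have hν : ∀ k, IsProbabilityMeasure (ν k) := fun k => ⟨by
    simp only [ν, Measure.smul_apply, Measure.finsetSum_apply, measure_univ, Finset.sum_const,
      Finset.card_range, smul_eq_mul, nsmul_eq_mul, mul_one]
    exact ENNReal.inv_mul_cancel (by simpa using (hM0 k).ne') (by simp)⟩
  have hint : ∀ (f : α → ℝ) (k : ℕ),
      ∫ q, f q ∂(ν k) = (M k : ℝ)⁻¹ * birkhoffSum T f (M k) (y k) := by
    intro f k
    simp only [ν, birkhoffSum]
    rw [integral_smul_measure, integral_finsetSum_measure fun j _ => integrable_dirac (by simp)]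
    simp
  let U : Ultrafilter ℕ := hyperfilter ℕ
  have hU : (U : Filter ℕ) ≤ atTop := Nat.hyperfilter_le_atTop
  let ν' : ℕ → ProbabilityMeasure α := fun k => ⟨ν k, hν k⟩
  obtain ⟨m, -, hm⟩ := isCompact_univ.ultrafilter_le_nhds (U.map ν') (by simp)
  have hlim : ∀ f : α → ℝ, Continuous f →
      Tendsto (fun k => (M k : ℝ)⁻¹ * birkhoffSum T f (M k) (y k)) U (𝓝 (∫ q, f q ∂(m : Measure α))) := by
    intro f hf
    have h := ProbabilityMeasure.tendsto_iff_forall_integral_tendsto.1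
      (show Tendsto ν' U (𝓝 m) from hm) (BoundedContinuousFunction.mkOfCompact ⟨f, hf⟩)
    simpa [ν', hint] using h
  refine ⟨m, ⟨m.2, hT.measurable, ?_⟩, fun f hf c hc => tendsto_nhds_unique (hlim f hf) (hc.mono_left hU)⟩
  have : IsProbabilityMeasure ((m : Measure α).map T) :=
    Measure.isProbabilityMeasure_map hT.measurable.aemeasurable
  refine ext_of_forall_integral_eq_of_IsFiniteMeasure fun f => ?_
  rw [integral_map hT.measurable.aemeasurable f.continuous.aestronglyMeasurable]
  refine tendsto_nhds_unique (hlim _ (f.continuous.comp hT)) ?_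
  -- the Birkhoff sums of `f ∘ T` and of `f` differ by a bounded boundary term
  have hz : Tendsto (fun k => (M k : ℝ)⁻¹ * (f (T^[M k] (y k)) - f (y k))) U (𝓝 0) := by
    refine squeeze_zero_norm (a := fun k => (M k : ℝ)⁻¹ * (2 * ‖f‖)) (fun k => ?_) ?_
    · rw [norm_mul, norm_inv, Real.norm_natCast]
      gcongr
      refine (norm_sub_le _ _).trans ?_
      linarith [f.norm_coe_le_norm (T^[M k] (y k)), f.norm_coe_le_norm (y k)]
    · have := ((tendsto_inv_atTop_nhds_zero_nat (𝕜 := ℝ)).comp (hM.mono_left hU)).mul_const (2 * ‖f‖)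
      simpa using this
  have hsum := (hlim f f.continuous).add hz
  rw [add_zero] at hsum
  refine hsum.congr fun k => ?_
  rw [← mul_add, ← birkhoffSum_apply_sub_birkhoffSum, add_sub_cancel]
  simp [birkhoffSum, ← Function.iterate_succ_apply', Function.iterate_succ_apply]

namespace RCTH.Lift

variable {X : Type*} [MetricSpace X] [CompactSpace X] [MeasurableSpace X] [BorelSpace X]
  {F : RCTH X} (L : F.Lift)

theorem map_fst_mem_orbitMeasures {x : ℤ → X} {m : Measure ((ℤ → X) × T2)}
    (hm : m ∈ invMeasures F.map) (hsupp : ∀ᵐ q ∂m, q.1 ∈ range fun k : ℕ => shift^[k] x)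
    (hmeas : MeasurableSet (range fun k : ℕ => shift^[k] x)) :
    m.map Prod.fst ∈ orbitMeasures x := by
  obtain ⟨hprob, hinv⟩ := hm
  refine ⟨⟨Measure.isProbabilityMeasure_map measurable_fst.aemeasurable,
    continuous_shift.measurable, ?_⟩, ?_⟩
  · rw [Measure.map_map continuous_shift.measurable measurable_fst]
    have : (shift ∘ Prod.fst : (ℤ → X) × T2 → (ℤ → X)) = Prod.fst ∘ F.map := rfl
    rw [this, ← Measure.map_map measurable_fst hinv.measurable, hinv.map_eq]
  · rw [Measure.map_apply measurable_fst hmeas.compl]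
    exact hsupp

open Filter Topology in
theorem exists_rotVec_eq_of_mem_planeRotationSet {x : ℤ → X} {n : ℕ} (hn : 0 < n)
    (hx : Function.IsPeriodicPt shift n x) {w : R2} (hw : w ∈ planeRotationSet (L.iter n x)) :
    (n : ℝ)⁻¹ • w ∈ L.rhoOrbit x := by
  have hfin : (range fun k : ℕ => shift^[k] x).Finite := by
    refine (Set.finite_range fun k : Fin n => shift^[(k : ℕ)] x).subset ?_
    rintro _ ⟨k, rfl⟩
    exact ⟨⟨k % n, Nat.mod_lt _ hn⟩, hx.iterate_mod_apply k⟩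
  set A := range fun k : ℕ => shift^[k] x
  have hAne : A.Nonempty := ⟨x, 0, rfl⟩
  have h1 : ∀ k : ℕ, ∃ N : ℕ, ∃ p : R2, k + 1 ≤ N ∧
      dist w ((N : ℝ)⁻¹ • ((L.iter n x)^[N] p - p)) < 1 / ((k : ℝ) + 1) := fun k => by
    obtain ⟨v, hv, hd⟩ := Metric.mem_closure_iff.1 (mem_iInter.1 hw (k + 1)) _
      (Nat.one_div_pos_of_nat (n := k))
    obtain ⟨N, hN, p, rfl⟩ := mem_iUnion₂.1 hv
    exact ⟨N, p, hN, hd⟩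
  choose N p hN hd using h1
  have hlim : Tendsto (fun k => (N k : ℝ)⁻¹ • ((L.iter n x)^[N k] (p k) - p k)) atTop (𝓝 w) := by
    rw [tendsto_iff_dist_tendsto_zero]
    refine squeeze_zero (fun _ => dist_nonneg) (fun k => ?_) tendsto_one_div_add_atTop_nhds_zero_nat
    rw [dist_comm]; exact (hd k).le
  obtain ⟨m, hm, hint⟩ := exists_invariant_integral_eq_limit F.continuous_map
    (fun k => (x, proj (p k))) (M := fun k => n * N k)
    (fun k => Nat.mul_pos hn (by have := hN k; omega))
    (tendsto_atTop_mono (fun k => ((Nat.le_succ k).trans (hN k)).trans (Nat.le_mul_of_pos_left _ hn))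
      tendsto_id)
  have hprob := hm.1
  have hsupp : ∀ᵐ q ∂m, q.1 ∈ A := by
    -- the distance to the finite orbit vanishes along all the orbit segments
    let _ : MetricSpace (ℤ → X) := TopologicalSpace.metrizableSpaceMetric (ℤ → X)
    have hf : Continuous fun q : (ℤ → X) × T2 => Metric.infDist q.1 A :=
      (Metric.continuous_infDist_pt A).comp continuous_fst
    have h0 := hint _ hf 0 (tendsto_const_nhds.congr fun k => by
      refine (mul_eq_zero_of_right _ (Finset.sum_eq_zero fun j _ => ?_)).symm
      simp only [F.fst_map_iterate]
      exact Metric.infDist_zero_of_mem ⟨j, rfl⟩)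
    rw [integral_eq_zero_iff_of_nonneg (fun q => Metric.infDist_nonneg)
      ((BoundedContinuousFunction.mkOfCompact ⟨_, hf⟩).integrable m)] at h0
    filter_upwards [h0] with q hq
    exact (hfin.isClosed.mem_iff_infDist_zero hAne).2 hq
  refine mem_iUnion₂.2 ⟨m.map Prod.fst, map_fst_mem_orbitMeasures hm hsupp hfin.measurableSet,
    m, ⟨hm, rfl⟩, ?_⟩
  funext i
  have h2 := hint (fun q => L.disp q i) ((continuous_apply i).comp L.continuous_disp)
    (((n : ℝ)⁻¹ • w) i) ?_
  · rw [← h2, rotVec]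
    exact ((ContinuousLinearMap.proj (R := ℝ) (φ := fun _ : Fin 2 => ℝ) i).integral_comp_comm
      (L.integrable_disp m)).symm
  · have h3 := ((tendsto_pi_nhds.1 hlim) i).const_mul (n : ℝ)⁻¹
    refine h3.congr fun k => ?_
    have h4 : birkhoffSum F.map (fun q => L.disp q i) (n * N k) (x, proj (p k))
        = (L.iter (n * N k) x (p k) - p k) i := by
      rw [← L.birkhoffSum_disp]; simp [birkhoffSum]
    simp only [h4, L.iterate_iter hx, Pi.smul_apply, smul_eq_mul]
    push_cast
    rw [mul_inv, mul_assoc]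

theorem rhoOrbit_eq {x : ℤ → X} {n : ℕ} (hn : 0 < n) (hx : Function.IsPeriodicPt shift n x) :
    L.rhoOrbit x = (fun v : R2 => (n : ℝ)⁻¹ • v) '' planeRotationSet (L.iter n x) := by
  have hn' : (n : ℝ) ≠ 0 := by exact_mod_cast hn.ne'
  refine Subset.antisymm (fun v hv => ?_) ?_
  · obtain ⟨μ, hμ, m, ⟨hm, rfl⟩, rfl⟩ := mem_iUnion₂.1 hv
    refine ⟨_, L.smul_rotVec_mem_planeRotationSet hn hx hm ?_, inv_smul_smul₀ hn' _⟩
    exact ae_of_ae_map measurable_fst.aemeasurable (mem_ae_iff.2 hμ.2)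
  · rintro _ ⟨w, hw, rfl⟩
    exact L.exists_rotVec_eq_of_mem_planeRotationSet hn hx hw

theorem rhoOrbit_subset_rhoMZ {x : ℤ → X} (hx : x ∈ Function.periodicPts (shift (X := X))) :
    L.rhoOrbit x ⊆ L.rhoMZ := by
  obtain ⟨n, hn, hx⟩ := hx
  rw [L.rhoOrbit_eq hn hx]
  rintro _ ⟨w, hw, rfl⟩
  refine mem_iInter.2 fun N => ?_
  refine map_mem_closure (f := fun v : R2 => (n : ℝ)⁻¹ • v) (by fun_prop) (mem_iInter.1 hw N) ?_
  intro v hv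
  obtain ⟨k, hk, p, rfl⟩ := mem_iUnion₂.1 hv
  refine mem_iUnion₂.2 ⟨n * k, hk.trans (Nat.le_mul_of_pos_left k hn), x, p, ?_⟩
  simp only [L.iterate_iter hx, smul_smul]
  push_cast
  rw [mul_inv]

end RCTH.Lift
end TorusCocycle

theorem mainTheorem6 {X : Type*} [MetricSpace X] [CompactSpace X]
    [MeasurableSpace X] [BorelSpace X]
    (F : TorusCocycle.RCTH X) (L : F.Lift) :
    L.rhoPer ⊆ L.rhoMZ ∧
    ∀ (x : ℤ → X) (n : ℕ), 0 < n → Function.IsPeriodicPt TorusCocycle.shift n x →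
      L.rhoOrbit x =
        (fun v : TorusCocycle.R2 => (n : ℝ)⁻¹ • v) ''
          TorusCocycle.planeRotationSet (L.iter n x) := by
  refine ⟨fun v hv => ?_, fun x n hn hx => L.rhoOrbit_eq hn hx⟩
  simp only [TorusCocycle.RCTH.Lift.rhoPer, TorusCocycle.perMeasures, mem_iUnion] at hv
  obtain ⟨μ, ⟨x, hx, hμ⟩, hv⟩ := hv
  exact L.rhoOrbit_subset_rhoMZ hx (mem_iUnion₂.2 ⟨μ, hμ, hv⟩)
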